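/- For $\zeta\in\mathbb{C}$ and a sequence $(z_k)$ in the unit disc $\mathbb{D}=\{z\in\mathbb{C}:|z|<1\}$, let $n_\zeta(t)$ be the number of indices $k$ with $|z_k-\zeta|\le t$, and let $N_\zeta(r)=\int_0^r \frac{(n_\zeta(t)-1)^+}{t}\,dt$. For $a$ analytic in $\mathbb{D}$ let $M(r,a)=\max\{|a(z)|:|z|=r\}$, $0<r<1$. Theorem. For every $\rho>0$ there is a sequence $(z_k)_{k\ge 0}$ of distinct points of $\mathbb{D}$ with the following properties. i) There is a constant $C>0$ such that $N_{z_k}\bigl(\frac{1-|z_k|}{2}\bigr)\le C\bigl(\frac{1}{1-|z_k|}\bigr)^{\rho}$ for all $k$. ii) For every $\varepsilon_0>0$ there are no functions $a$ and $f$ analytic in $\mathbb{D}$ such that $\ln M(r,a)\le C'(1-r)^{-\rho+\varepsilon_0}$ for some constant $C'>0$ and all $r<1$ sufficiently close to $1$, $f''+af=0$ in $\mathbb{D}$, and the zeros of $f$ in $\mathbb{D}$ are precisely the points $z_k$. Moreover, the sequence can be taken to consist of pairs of real points: with $\varepsilon_n=\frac12 e^{-2^{n\rho}}$ and some integer $N\ge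 1$ (depending on $\rho$), $z_{2j}=1-2^{-(N+j)}$ and $z_{2j+1}=1-2^{-(N+j)}+\varepsilon_{N+j}$ for all $j\ge 0$. -/

import Mathlib

open Filter Topology MeasureTheory
open scoped ENNReal

/-- The number `n_ζ(t)` of indices `k` with `|z_k - ζ| ≤ t` (possibly infinite). -/
noncomputable def countPts (z : ℕ → ℂ) (ζ : ℂ) (t : ℝ) : ℝ≥0∞ :=
  (({k : ℕ | ‖z k - ζ‖ ≤ t}.encard : ℕ∞) : ℝ≥0∞)

/-- The integrated counting function `N_ζ(r) = ∫_0^r (n_ζ(t) - 1)⁺ / t dt`, with values in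
`[0, ∞]`; subtraction in `[0, ∞]` is truncated at `0`, so it is the positive part. -/
noncomputable def integratedCount (z : ℕ → ℂ) (ζ : ℂ) (r : ℝ) : ℝ≥0∞ :=
  ∫⁻ t in Set.Ioc (0 : ℝ) r, (countPts z ζ t - 1) / ENNReal.ofReal t

/-- The maximum modulus `M(r, f) = max {|f(z)| : |z| = r}`. -/
noncomputable def maxModulus (r : ℝ) (f : ℂ → ℂ) : ℝ :=
  sSup ((fun w : ℂ => ‖f w‖) '' Metric.sphere (0 : ℂ) r)

/-- `ln M(r, a) = O((1 - r)^s)` as `r → 1-`, read as an upper bound. -/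
def LogMaxModulusBigO (a : ℂ → ℂ) (s : ℝ) : Prop :=
  ∃ C : ℝ, 0 < C ∧ ∀ᶠ r : ℝ in 𝓝[<] (1 : ℝ), Real.log (maxModulus r a) ≤ C * (1 - r) ^ s

/-- `f` is an analytic solution of `f'' + a f = 0` in the unit disc. -/
def IsDiscSolution (a f : ℂ → ℂ) : Prop :=
  DifferentiableOn ℂ f (Metric.ball (0 : ℂ) 1) ∧
    ∀ w ∈ Metric.ball (0 : ℂ) 1, deriv (deriv f) w + a w * f w = 0

/-- The zeros of `f` in the unit disc are precisely the points `z_k`. Nontrivial solutions of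
`f'' + a f = 0` have only simple zeros, so multiplicities need not be recorded. -/
def HasZerosPreciselyAt (f : ℂ → ℂ) (z : ℕ → ℂ) : Prop :=
  {w : ℂ | w ∈ Metric.ball (0 : ℂ) 1 ∧ f w = 0} = Set.range z

/-- The gap `ε_n = ½ exp(-2^{nρ})`. -/
noncomputable def pairGap (ρ : ℝ) (n : ℕ) : ℝ :=
  1 / 2 * Real.exp (-((2 : ℝ) ^ ((n : ℝ) * ρ)))

/-! Two close zeros of a solution of f'' + af = 0 force a to be large between them. If |a| ≤ M on
the segment joining zeros at distance δ, two integrations of f'' = -af bound max |f| there by 2Mδ²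
max |f|, so 1 ≤ 2Mδ² (`one_le_two_mul_mul_sq_of_zeros`). For the n-th pair δ² = ¼ exp(-2·2^{nρ}),
while growth of order σ < ρ only allows M = exp(O(2^{nσ})), a contradiction for large n. The
counting condition still holds with exponent ρ: a disc about z_k of radius (1-|z_k|)/2 meets at most
two pairs, so N is at most 3 log(1/ε_n), which is O(2^{nρ}) (`integratedCount_pairPoint_le`). -/

/-- Two zeros `x ≠ y` of a function with `‖f''‖ ≤ M ‖f‖` on the segment between them, where `f`
does not vanish identically, cannot be too close to each other. -/
theorem one_le_two_mul_mul_sq_of_zeros {U : Set ℂ} (hU : IsOpen U) {f : ℂ → ℂ}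
    (hf : DifferentiableOn ℂ f U) {x y : ℂ} (hxy : x ≠ y) (hseg : segment ℝ x y ⊆ U) {M : ℝ}
    (hM : ∀ w ∈ segment ℝ x y, ‖deriv (deriv f) w‖ ≤ M * ‖f w‖) (hM0 : 0 ≤ M)
    (hx : f x = 0) (hy : f y = 0) (hne : ∃ w ∈ segment ℝ x y, f w ≠ 0) :
    1 ≤ 2 * M * ‖y - x‖ ^ 2 := by
  have hconv : Convex ℝ (segment ℝ x y) := convex_segment x y
  have hxS : x ∈ segment ℝ x y := left_mem_segment ℝ x y
  have hyS : y ∈ segment ℝ x y := right_mem_segment ℝ x y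
  have hcomp : IsCompact (segment ℝ x y) := by
    rw [segment_eq_image_lineMap]
    exact isCompact_Icc.image AffineMap.lineMap_continuous
  obtain ⟨c, hc, hcmax⟩ := hcomp.exists_isMaxOn ⟨x, hxS⟩ (hf.continuousOn.mono hseg).norm
  have hle : ∀ w ∈ segment ℝ x y, ‖f w‖ ≤ ‖f c‖ := fun w hw => hcmax hw
  have hcpos : 0 < ‖f c‖ := by
    obtain ⟨w, hw, hfw⟩ := hne
    exact (norm_pos_iff.2 hfw).trans_le (hle w hw)
  set δ := ‖y - x‖ with hδ
  have hδpos : 0 < δ := norm_pos_iff.2 (sub_ne_zero.2 hxy.symm)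
  have hdist : ∀ w ∈ segment ℝ x y, ‖w - x‖ ≤ δ := fun w hw => by
    rw [hδ, ← dist_eq_norm, ← dist_eq_norm, dist_comm y x, ← dist_add_dist_of_mem_segment hw,
      dist_comm w x]
    exact le_add_of_nonneg_right dist_nonneg
  have hd1 : ∀ w ∈ segment ℝ x y, HasDerivAt f (deriv f w) w := fun w hw =>
    (hf.differentiableAt (hU.mem_nhds (hseg hw))).hasDerivAt
  have hd2 : ∀ w ∈ segment ℝ x y, HasDerivAt (deriv f) (deriv (deriv f) w) w := fun w hw =>
    ((hf.deriv hU).differentiableAt (hU.mem_nhds (hseg hw))).hasDerivAt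
  set K := M * ‖f c‖ with hK
  have hK0 : 0 ≤ K := mul_nonneg hM0 hcpos.le
  have hA : ∀ w ∈ segment ℝ x y, ‖deriv f w - deriv f x‖ ≤ K * δ := fun w hw =>
    (hconv.norm_image_sub_le_of_norm_hasDerivWithin_le
      (fun v hv => (hd2 v hv).hasDerivWithinAt)
      (fun v hv => (hM v hv).trans (mul_le_mul_of_nonneg_left (hle v hv) hM0)) hxS hw).trans
      (mul_le_mul_of_nonneg_left (hdist w hw) hK0)
  -- Rolle's theorem fails for complex values; the mean value inequality for f(v) - f'(x)v, with
  -- f(x) = f(y) = 0, bounds f'(x) instead.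
  have hB : ‖(f y - deriv f x * y) - (f x - deriv f x * x)‖ ≤ K * δ * ‖y - x‖ :=
    hconv.norm_image_sub_le_of_norm_hasDerivWithin_le (f := fun v => f v - deriv f x * v)
      (f' := fun v => deriv f v - deriv f x)
      (fun v hv => by
        have h := (hd1 v hv).sub ((hasDerivAt_id v).const_mul (deriv f x))
        rw [mul_one] at h
        exact h.hasDerivWithinAt)
      hA hxS hyS
  have hB' : ‖deriv f x‖ ≤ K * δ := by
    have h : (f y - deriv f x * y) - (f x - deriv f x * x) = -(deriv f x * (y - x)) := by
      rw [hx, hy]; ring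
    rw [h, norm_neg, norm_mul] at hB
    exact le_of_mul_le_mul_right hB hδpos
  have hD : ∀ w ∈ segment ℝ x y, ‖deriv f w‖ ≤ 2 * K * δ := fun w hw => by
    have h := norm_add_le (deriv f w - deriv f x) (deriv f x)
    rw [sub_add_cancel] at h
    linarith [hA w hw]
  have hE := hconv.norm_image_sub_le_of_norm_hasDerivWithin_le
    (fun v hv => (hd1 v hv).hasDerivWithinAt) hD hxS hc
  rw [hx, sub_zero] at hE
  have hF : ‖f c‖ ≤ 2 * K * δ * δ :=
    hE.trans (mul_le_mul_of_nonneg_left (hdist c hc) (by positivity))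
  have hG : 1 * ‖f c‖ ≤ (2 * M * δ ^ 2) * ‖f c‖ := by
    calc 1 * ‖f c‖ ≤ 2 * K * δ * δ := by rw [one_mul]; exact hF
      _ = _ := by rw [hK]; ring
  exact le_of_mul_le_mul_right hG hcpos

theorem norm_le_maxModulus {a : ℂ → ℂ} (ha : ContinuousOn a (Metric.ball (0 : ℂ) 1)) {w : ℂ}
    (hw : ‖w‖ < 1) : ‖a w‖ ≤ maxModulus ‖w‖ a := by
  refine le_csSup ?_ ⟨w, by simp, rfl⟩
  refine ((isCompact_sphere (0 : ℂ) ‖w‖).image_of_continuousOn (ha.mono ?_).norm).bddAbove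
  intro v hv
  rw [mem_sphere_zero_iff_norm] at hv
  rwa [mem_ball_zero_iff, hv]

/-- An interval is uncountable. With S the zero set of f, this gives a point between the paired
zeros where f does not vanish. -/
theorem exists_mem_Icc_ofReal_notMem {x y : ℝ} (hxy : x < y) {S : Set ℂ} (hS : S.Countable) :
    ∃ t ∈ Set.Icc x y, (t : ℂ) ∉ S := by
  by_contra! h
  have h1 : (Set.Icc x y).Countable :=
    (hS.preimage Complex.ofReal_injective).mono fun t ht => h t ht
  exact (Cardinal.Real.Icc_countable_iff.1 h1).not_gt hxy

theorem exists_ofReal_of_mem_segment {x y : ℝ} (hxy : x ≤ y) {w : ℂ}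
    (hw : w ∈ segment ℝ (x : ℂ) (y : ℂ)) : ∃ t ∈ Set.Icc x y, (t : ℂ) = w := by
  have h : segment ℝ (x : ℂ) (y : ℂ) = Complex.ofRealCLM '' segment ℝ x y :=
    (image_segment ℝ (Complex.ofRealCLM : ℝ →ₗ[ℝ] ℂ).toAffineMap x y).symm
  rw [h, segment_eq_Icc hxy] at hw
  exact hw

theorem ofReal_mem_segment {x y t : ℝ} (ht : t ∈ Set.Icc x y) :
    (t : ℂ) ∈ segment ℝ (x : ℂ) (y : ℂ) := by
  have h : segment ℝ (x : ℂ) (y : ℂ) = Complex.ofRealCLM '' segment ℝ x y :=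
    (image_segment ℝ (Complex.ofRealCLM : ℝ →ₗ[ℝ] ℂ).toAffineMap x y).symm
  rw [h, segment_eq_Icc (ht.1.trans ht.2)]
  exact ⟨t, ht, rfl⟩

/-! ### Geometry of the sequence of pairs -/

theorem pairGap_pos (ρ : ℝ) (n : ℕ) : 0 < pairGap ρ n := by
  unfold pairGap; positivity

theorem two_rpow_mul_eq (ρ : ℝ) (n : ℕ) : (2 : ℝ) ^ ((n : ℝ) * ρ) = ((2 : ℝ) ^ n) ^ ρ := by
  rw [Real.rpow_mul (by norm_num), Real.rpow_natCast]

theorem eventually_pairGap_le {ρ : ℝ} (hρ : 0 < ρ) :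
    ∀ᶠ n : ℕ in atTop, pairGap ρ n ≤ 1 / (2 : ℝ) ^ n / 16 := by
  have h1 : Tendsto (fun n : ℕ => ((2 : ℝ) ^ n) ^ ρ) atTop atTop :=
    (tendsto_rpow_atTop hρ).comp (tendsto_pow_atTop_atTop_of_one_lt (by norm_num))
  -- With s = 2^{nρ}, s^{1/ρ} e^{-s} is 2^n e^{-s}, that is 2·2^n ε_n; this explains the threshold
  -- 1/8.
  have h2 := (tendsto_rpow_mul_exp_neg_mul_atTop_nhds_zero ρ⁻¹ 1 one_pos).comp h1
  filter_upwards [h2.eventually_le_const (show (0 : ℝ) < 1 / 8 by norm_num)] with n hn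
  have hpos : (0 : ℝ) < 2 ^ n := by positivity
  simp only [Function.comp, neg_mul, one_mul] at hn
  rw [Real.rpow_rpow_inv hpos.le hρ.ne'] at hn
  rw [pairGap, two_rpow_mul_eq, div_div, le_div_iff₀ (by positivity)]
  linarith

/-- The `k`-th point of the sequence of pairs, as a real number. -/
noncomputable def pairPoint (ρ : ℝ) (N k : ℕ) : ℝ :=
  1 - 1 / (2 : ℝ) ^ (N + k / 2) + if k % 2 = 0 then 0 else pairGap ρ (N + k / 2)



theorem pairPoint_mem_Icc {ρ : ℝ} {N : ℕ}
    (hN : ∀ n, N ≤ n → pairGap ρ n ≤ 1 / (2 : ℝ) ^ n / 16) (k : ℕ) : pairPoint ρ N k ∈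
    Set.Icc (1 - 1 / (2 : ℝ) ^ (N + k / 2)) (1 - 1 / (2 : ℝ) ^ (N + k / 2) * (15 / 16)) := by
  have h1 := hN (N + k / 2) (Nat.le_add_right _ _)
  have h2 := pairGap_pos ρ (N + k / 2)
  unfold pairPoint
  split_ifs <;> constructor <;> linarith


theorem one_div_two_pow_le {m n : ℕ} (h : m + 1 ≤ n) :
    1 / (2 : ℝ) ^ n ≤ 1 / (2 : ℝ) ^ m / 2 := by
  rw [div_div, ← pow_succ]
  exact one_div_le_one_div_of_le (by positivity) (pow_le_pow_right₀ (by norm_num) h)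

theorem pairPoint_bounds {ρ : ℝ} {N : ℕ}
    (hN : ∀ n, N ≤ n → pairGap ρ n ≤ 1 / (2 : ℝ) ^ n / 16) (k : ℕ) (hN1 : 1 ≤ N) :
    0 < pairPoint ρ N k ∧ pairPoint ρ N k < 1 := by
  obtain ⟨h1, h2⟩ := pairPoint_mem_Icc hN k
  have h3 : 0 < 1 / (2 : ℝ) ^ (N + k / 2) := by positivity
  have h4 := one_div_two_pow_le (show 0 + 1 ≤ N + k / 2 by omega)
  rw [pow_zero] at h4
  constructor <;> linarith

/-- Distinct points are at least the gap of the pair of the first one apart. -/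
theorem pairGap_le_dist {ρ : ℝ} {N : ℕ}
    (hN : ∀ n, N ≤ n → pairGap ρ n ≤ 1 / (2 : ℝ) ^ n / 16) {k l : ℕ} (hkl : k ≠ l) :
    pairGap ρ (N + k / 2) ≤ |pairPoint ρ N l - pairPoint ρ N k| := by
  have hg := pairGap_pos ρ (N + k / 2)
  have hg' := hN (N + k / 2) (Nat.le_add_right _ _)
  have hpos : 0 < 1 / (2 : ℝ) ^ (N + k / 2) := by positivity
  obtain ⟨h1, h2⟩ := pairPoint_mem_Icc hN k
  obtain ⟨h3, h4⟩ := pairPoint_mem_Icc hN l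
  rcases lt_trichotomy (k / 2) (l / 2) with h | h | h
  · have h5 := one_div_two_pow_le (show N + k / 2 + 1 ≤ N + l / 2 by omega)
    refine le_trans ?_ (le_abs_self _)
    linarith
  · unfold pairPoint
    rw [← h]
    rcases Nat.mod_two_eq_zero_or_one k with hk | hk <;>
      rcases Nat.mod_two_eq_zero_or_one l with hl | hl
    · omega
    · simp [hk, hl, abs_of_pos hg]
    · simp [hk, hl, abs_of_pos hg]
    · omega
  · have h5 := one_div_two_pow_le (show N + l / 2 + 1 ≤ N + k / 2 by omega)
    refine le_trans ?_ (neg_le_abs _)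
    linarith

/-- With d = 2^{-n} the radius is at most d/2. Earlier pairs are at least 7d/8 away, and from the
second next pair on the points lie beyond 1 - d/4, out of reach. -/
theorem div_two_of_dist_pairPoint_le {ρ : ℝ} {N : ℕ}
    (hN : ∀ n, N ≤ n → pairGap ρ n ≤ 1 / (2 : ℝ) ^ n / 16) {k l : ℕ}
    (h : |pairPoint ρ N l - pairPoint ρ N k| ≤ (1 - pairPoint ρ N k) / 2) :
    l / 2 = k / 2 ∨ l / 2 = k / 2 + 1 := by
  have hpos : 0 < 1 / (2 : ℝ) ^ (N + k / 2) := by positivity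
  obtain ⟨h1, h2⟩ := pairPoint_mem_Icc hN k
  obtain ⟨h3, h4⟩ := pairPoint_mem_Icc hN l
  by_contra! hne
  rcases lt_or_gt_of_ne hne.1 with hlt | hgt
  · have h5 := one_div_two_pow_le (show N + l / 2 + 1 ≤ N + k / 2 by omega)
    linarith [neg_le_abs (pairPoint ρ N l - pairPoint ρ N k)]
  · have h5 := one_div_two_pow_le (show N + k / 2 + 1 ≤ N + k / 2 + 1 by omega)
    have h6 := one_div_two_pow_le (show N + k / 2 + 1 + 1 ≤ N + l / 2 by omega)
    linarith [le_abs_self (pairPoint ρ N l - pairPoint ρ N k)]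

/-! ### Bound for the integrated counting function -/

theorem lintegral_Icc_three_div {ε : ℝ} (hε : 0 < ε) (hε1 : ε ≤ 1) :
    ∫⁻ t in Set.Icc ε 1, 3 / ENNReal.ofReal t = ENNReal.ofReal (3 * Real.log (1 / ε)) := by
  have hcont : ContinuousOn (fun t : ℝ => 3 * (1 / t)) (Set.Icc ε 1) := by
    refine continuousOn_const.mul (continuousOn_const.div continuousOn_id fun t ht => ?_)
    exact (hε.trans_le ht.1).ne'
  have h1 : ∫ t in Set.Icc ε 1, 3 * (1 / t) = 3 * Real.log (1 / ε) := by
    rw [integral_Icc_eq_integral_Ioc, ← intervalIntegral.integral_of_le hε1,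
      intervalIntegral.integral_const_mul, integral_one_div_of_pos hε one_pos]
  rw [← h1, ofReal_integral_eq_lintegral_ofReal hcont.integrableOn_Icc]
  · refine setLIntegral_congr_fun measurableSet_Icc fun t ht => ?_
    have ht0 : 0 < t := hε.trans_le ht.1
    rw [mul_one_div, ENNReal.ofReal_div_of_pos ht0]
    norm_num
  · refine (ae_restrict_iff' measurableSet_Icc).2 (Eventually.of_forall fun t ht => ?_)
    have ht0 : 0 < t := hε.trans_le ht.1
    simp only [Pi.zero_apply]
    positivity

/-- If `n_ζ(t) ≤ 4` for `t ≤ r ≤ 1` and `n_ζ(t) ≤ 1` for `t < ε`, then `N_ζ(r) ≤ 3 log (1 / ε)`. -/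
theorem integratedCount_le {z : ℕ → ℂ} {ζ : ℂ} {ε r : ℝ} (hε : 0 < ε) (hε1 : ε ≤ 1) (hr : r ≤ 1)
    (h1 : ∀ t < ε, countPts z ζ t ≤ 1) (h4 : ∀ t ≤ r, countPts z ζ t ≤ 4) :
    integratedCount z ζ r ≤ ENNReal.ofReal (3 * Real.log (1 / ε)) := by
  rw [← lintegral_Icc_three_div hε hε1, integratedCount, ← lintegral_indicator measurableSet_Ioc,
    ← lintegral_indicator measurableSet_Icc]
  refine lintegral_mono fun t => ?_
  by_cases ht : t ∈ Set.Ioc 0 r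
  · rw [Set.indicator_of_mem ht]
    by_cases hεt : ε ≤ t
    · rw [Set.indicator_of_mem (show t ∈ Set.Icc ε 1 from ⟨hεt, ht.2.trans hr⟩)]
      refine ENNReal.div_le_div_right (tsub_le_iff_right.2 ((h4 t ht.2).trans_eq ?_)) _
      norm_num
    · rw [tsub_eq_zero_of_le (h1 t (not_le.1 hεt)), ENNReal.zero_div]
      exact zero_le
  · rw [Set.indicator_of_notMem ht]
    exact zero_le

theorem countPts_le_natCast {z : ℕ → ℂ} {ζ : ℂ} {t : ℝ} (s : Finset ℕ)
    (h : ∀ k, ‖z k - ζ‖ ≤ t → k ∈ s) : countPts z ζ t ≤ (s.card : ℝ≥0∞) := by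
  have h1 : {k : ℕ | ‖z k - ζ‖ ≤ t}.encard ≤ ((s.card : ℕ∞)) := by
    rw [← Set.encard_coe_eq_coe_finsetCard]
    exact Set.encard_le_encard fun k hk => h k hk
  have h2 : (({k : ℕ | ‖z k - ζ‖ ≤ t}.encard : ℕ∞) : ℝ≥0∞) ≤ ((s.card : ℕ∞) : ℝ≥0∞) := by
    exact_mod_cast h1
  simpa [countPts] using h2

theorem integratedCount_pairPoint_le {ρ : ℝ} (hρ : 0 < ρ) {N : ℕ} (hN1 : 1 ≤ N)
    (hN : ∀ n, N ≤ n → pairGap ρ n ≤ 1 / (2 : ℝ) ^ n / 16) (k : ℕ) :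
    integratedCount (fun k => (pairPoint ρ N k : ℂ)) (pairPoint ρ N k)
        ((1 - pairPoint ρ N k) / 2) ≤
      ENNReal.ofReal (6 * (1 / (1 - pairPoint ρ N k)) ^ ρ) := by
  have hg := pairGap_pos ρ (N + k / 2)
  have hg' := hN (N + k / 2) (Nat.le_add_right _ _)
  obtain ⟨hp0, hp1⟩ := pairPoint_bounds hN k hN1
  have hpow : (1 : ℝ) ≤ 2 ^ (N + k / 2) := one_le_pow₀ (by norm_num)
  have hinv : 1 / (2 : ℝ) ^ (N + k / 2) ≤ 1 := by
    rw [div_le_one (by positivity)]; exact hpow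
  have hnorm : ∀ l, ‖(pairPoint ρ N l : ℂ) - pairPoint ρ N k‖ =
      |pairPoint ρ N l - pairPoint ρ N k| := fun l => by
    rw [← Complex.ofReal_sub, Complex.norm_real, Real.norm_eq_abs]
  refine (integratedCount_le hg (by linarith) (by linarith) (fun t ht => ?_)
    fun t ht => ?_).trans (ENNReal.ofReal_le_ofReal ?_)
  · refine (countPts_le_natCast {k} fun l hl => ?_).trans_eq (by simp)
    rw [hnorm] at hl
    by_contra hne
    rw [Finset.mem_singleton] at hne
    linarith [pairGap_le_dist hN (Ne.symm hne)]
  · refine (countPts_le_natCast (Finset.Ico (2 * (k / 2)) (2 * (k / 2) + 4)) fun l hl => ?_).trans_eq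
      (by simp)
    rw [hnorm] at hl
    rw [Finset.mem_Ico]
    rcases div_two_of_dist_pairPoint_le hN (hl.trans ht) with h | h <;> omega
  · have hlog : Real.log (1 / pairGap ρ (N + k / 2)) =
        Real.log 2 + ((2 : ℝ) ^ (N + k / 2)) ^ ρ := by
      have h2 : 1 / pairGap ρ (N + k / 2) = 2 * Real.exp (((2 : ℝ) ^ (N + k / 2)) ^ ρ) := by
        rw [pairGap, two_rpow_mul_eq, Real.exp_neg]
        field_simp
      rw [h2, Real.log_mul (by norm_num) (Real.exp_ne_zero _), Real.log_exp]
    have h1 : (2 : ℝ) ^ (N + k / 2) ≤ 1 / (1 - pairPoint ρ N k) := by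
      rw [le_div_iff₀ (by linarith), mul_comm, ← le_div_iff₀ (by positivity)]
      linarith [(pairPoint_mem_Icc hN k).1]
    have h2 := Real.rpow_le_rpow (by positivity) h1 hρ.le
    have h3 := Real.one_le_rpow hpow hρ.le
    -- Since log 2 < 1 ≤ 2^{nρ}, 3(log 2 + 2^{nρ}) ≤ 6·2^{nρ}: hence the constant 6.
    rw [hlog]
    linarith [Real.log_two_lt_d9]

/-! ### Nonexistence of the coefficient -/

theorem norm_le_exp_of_log_maxModulus_le {a : ℂ → ℂ}
    (ha : ContinuousOn a (Metric.ball (0 : ℂ) 1)) {t B : ℝ} (ht0 : 0 ≤ t) (ht1 : t < 1)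
    (h : Real.log (maxModulus t a) ≤ B) : ‖a t‖ ≤ Real.exp B := by
  -- Exponentiating the bound needs a positive maximum modulus, because `Real.log 0 = 0`.
  rcases eq_or_ne (a t) 0 with h0 | h0
  · rw [h0, norm_zero]
    exact (Real.exp_pos _).le
  · have hn : ‖(t : ℂ)‖ = t := by rw [Complex.norm_real, Real.norm_of_nonneg ht0]
    have h1 := norm_le_maxModulus ha (w := (t : ℂ)) (by rwa [hn])
    rw [hn] at h1
    have h2 := norm_pos_iff.2 h0
    exact h1.trans ((Real.log_le_iff_le_exp (h2.trans_le h1)).1 h)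

/-- The coefficient bound fails because the gaps `ε_n` force `|a|` to be at least
`2 exp (2 · 2^{nρ})` somewhere between the points of the `n`-th pair. -/
theorem not_exists_solution_of_pairs {ρ : ℝ} (hρ : 0 < ρ) {z : ℕ → ℂ} {N : ℕ}
    (hz : ∀ j : ℕ, z (2 * j) = ((1 - 1 / (2 : ℝ) ^ (N + j) : ℝ) : ℂ) ∧
      z (2 * j + 1) = ((1 - 1 / (2 : ℝ) ^ (N + j) + pairGap ρ (N + j) : ℝ) : ℂ))
    {ε₀ : ℝ} (hε₀ : 0 < ε₀) {a f : ℂ → ℂ} (ha : DifferentiableOn ℂ a (Metric.ball (0 : ℂ) 1))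
    (haM : LogMaxModulusBigO a (-ρ + ε₀)) (hf : IsDiscSolution a f)
    (hfz : HasZerosPreciselyAt f z) : False := by
  obtain ⟨C, hC, hCev⟩ := haM
  -- The term ρ/2 keeps σ positive even when ε₀ ≥ ρ.
  obtain ⟨σ, hσ0, hσρ, hσ⟩ : ∃ σ : ℝ, 0 < σ ∧ σ < ρ ∧ -σ ≤ -ρ + ε₀ :=
    ⟨max (ρ / 2) (ρ - ε₀), by positivity, max_lt (by linarith) (by linarith),
      by linarith [le_max_right (ρ / 2) (ρ - ε₀)]⟩
  obtain ⟨r₀, hr₀, hr⟩ := mem_nhdsLT_iff_exists_Ioo_subset.1 hCev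
  have hshift : Tendsto (fun j : ℕ => N + j) atTop atTop := by
    simpa only [add_comm N] using tendsto_add_atTop_nat N
  have htend : Tendsto (fun j : ℕ => (1 / (2 : ℝ)) ^ (N + j)) atTop (𝓝 0) :=
    (tendsto_pow_atTop_nhds_zero_of_lt_one (by norm_num) (by norm_num)).comp hshift
  have hgrow : Tendsto (fun j : ℕ => ((2 : ℝ) ^ (N + j)) ^ (ρ - σ)) atTop atTop :=
    (tendsto_rpow_atTop (sub_pos.2 hσρ)).comp
      ((tendsto_pow_atTop_atTop_of_one_lt (by norm_num)).comp hshift)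
  obtain ⟨j, hj1, hj2, hj3⟩ :=
    ((htend.eventually_lt_const (lt_min one_pos (sub_pos.2 hr₀))).and
      ((hgrow.eventually_gt_atTop (C * 2 ^ σ)).and
        (hshift.eventually (eventually_pairGap_le hρ)))).exists
  obtain ⟨hz0, hz1⟩ := hz j
  set n := N + j with hn
  have hgap := pairGap_pos ρ n
  set u : ℝ := 2 ^ n with hu
  have hupos : 0 < u := by positivity
  have hd : 0 < 1 / u := by positivity
  rw [one_div_pow, ← hu, lt_min_iff] at hj1
  set x : ℝ := 1 - 1 / u with hx
  set y : ℝ := x + pairGap ρ n with hy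
  have hxy : x < y := by linarith
  have hIcc : ∀ t ∈ Set.Icc x y, 0 < t ∧ t < 1 ∧ r₀ < t ∧ 1 / u / 2 ≤ 1 - t := fun t ht =>
    ⟨by linarith [ht.1], by linarith [ht.2], by linarith [ht.1], by linarith [ht.2]⟩
  have hball : ∀ t ∈ Set.Icc x y, (t : ℂ) ∈ Metric.ball (0 : ℂ) 1 := fun t ht => by
    rw [mem_ball_zero_iff, Complex.norm_real, Real.norm_of_nonneg (hIcc t ht).1.le]
    exact (hIcc t ht).2.1
  have hfzero : ∀ k, f (z k) = 0 := fun k => by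
    have h : z k ∈ Set.range z := ⟨k, rfl⟩
    rw [← hfz] at h
    exact h.2
  have hbound : ∀ t ∈ Set.Icc x y, ‖a t‖ ≤ Real.exp (C * (2 * u) ^ σ) := fun t ht => by
    obtain ⟨ht0, ht1, htr, htu⟩ := hIcc t ht
    refine norm_le_exp_of_log_maxModulus_le ha.continuousOn ht0.le ht1
      ((hr ⟨htr, ht1⟩ : Real.log (maxModulus t a) ≤ C * (1 - t) ^ (-ρ + ε₀)).trans ?_)
    refine mul_le_mul_of_nonneg_left ?_ hC.le
    calc (1 - t) ^ (-ρ + ε₀) ≤ (1 - t) ^ (-σ) :=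
          Real.rpow_le_rpow_of_exponent_ge (by linarith) (by linarith) hσ
      _ ≤ (1 / u / 2) ^ (-σ) := Real.rpow_le_rpow_of_nonpos (by positivity) htu (by linarith)
      _ = (2 * u) ^ σ := by
          rw [Real.rpow_neg (by positivity), ← Real.inv_rpow (by positivity)]
          congr 1
          field_simp
  have hkey := one_le_two_mul_mul_sq_of_zeros (U := Metric.ball (0 : ℂ) 1) (x := (x : ℂ))
    (y := (y : ℂ)) (M := Real.exp (C * (2 * u) ^ σ)) Metric.isOpen_ball hf.1
    (fun h => hxy.ne (Complex.ofReal_injective h))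
    (fun w hw => by
      obtain ⟨t, ht, rfl⟩ := exists_ofReal_of_mem_segment hxy.le hw
      exact hball t ht)
    (fun w hw => by
      obtain ⟨t, ht, rfl⟩ := exists_ofReal_of_mem_segment hxy.le hw
      rw [eq_neg_of_add_eq_zero_left (hf.2 t (hball t ht)), norm_neg, norm_mul]
      exact mul_le_mul_of_nonneg_right (hbound t ht) (norm_nonneg _))
    (Real.exp_pos _).le (hz0 ▸ hfzero _) (hz1 ▸ hfzero _)
    (by
      obtain ⟨t, ht, htz⟩ := exists_mem_Icc_ofReal_notMem hxy (Set.countable_range z)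
      refine ⟨t, ofReal_mem_segment ht, fun h => htz ?_⟩
      rw [← hfz]
      exact ⟨hball t ht, h⟩)
  have hnorm : ‖(y : ℂ) - x‖ = pairGap ρ n := by
    rw [← Complex.ofReal_sub, Complex.norm_real, hy, add_sub_cancel_left,
      Real.norm_of_nonneg hgap.le]
  have hexp : 2 * Real.exp (C * (2 * u) ^ σ) * pairGap ρ n ^ 2 =
      1 / 2 * Real.exp (C * (2 * u) ^ σ - 2 * u ^ ρ) := by
    rw [pairGap, two_rpow_mul_eq, mul_pow, ← Real.exp_nat_mul, Real.exp_sub, Nat.cast_ofNat,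
      mul_neg, Real.exp_neg]
    ring
  rw [hnorm, hexp] at hkey
  -- The choice of j gives u^{ρ-σ} > C·2^σ. The exponent in `hkey` is then nonpositive, so its right
  -- side is at most 1/2.
  have hlt : C * (2 * u) ^ σ ≤ 2 * u ^ ρ := by
    have h1 : u ^ ρ = u ^ (ρ - σ) * u ^ σ := by
      rw [← Real.rpow_add hupos, sub_add_cancel]
    have h2 : 0 < u ^ σ := Real.rpow_pos_of_pos hupos σ
    have h3 := mul_lt_mul_of_pos_right hj2 h2
    have h4 : 0 < u ^ ρ := Real.rpow_pos_of_pos hupos ρ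
    rw [Real.mul_rpow (by norm_num) hupos.le, ← mul_assoc]
    rw [← h1] at h3
    linarith
  have := Real.exp_le_one_iff.2 (sub_nonpos.2 hlt)
  linarith

theorem mainTheorem5 (ρ : ℝ) (hρ : 0 < ρ) :
    ∃ z : ℕ → ℂ, Function.Injective z ∧ (∀ k, z k ∈ Metric.ball (0 : ℂ) 1) ∧
      (∃ N : ℕ, 1 ≤ N ∧ ∀ j : ℕ,
        z (2 * j) = ((1 - 1 / (2 : ℝ) ^ (N + j) : ℝ) : ℂ) ∧
        z (2 * j + 1) = ((1 - 1 / (2 : ℝ) ^ (N + j) + pairGap ρ (N + j) : ℝ) : ℂ)) ∧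
      (∃ C : ℝ, 0 < C ∧ ∀ k,
        integratedCount z (z k) ((1 - ‖z k‖) / 2) ≤
          ENNReal.ofReal (C * (1 / (1 - ‖z k‖)) ^ ρ)) ∧
      (∀ ε₀ : ℝ, 0 < ε₀ → ¬ ∃ a f : ℂ → ℂ,
        DifferentiableOn ℂ a (Metric.ball (0 : ℂ) 1) ∧
        LogMaxModulusBigO a (-ρ + ε₀) ∧
        IsDiscSolution a f ∧
        HasZerosPreciselyAt f z) := by
  obtain ⟨N, hN⟩ := eventually_atTop.1 ((eventually_pairGap_le hρ).and (eventually_ge_atTop 1))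
  have hN1 : 1 ≤ N := (hN N le_rfl).2
  have hgap : ∀ n, N ≤ n → pairGap ρ n ≤ 1 / (2 : ℝ) ^ n / 16 := fun n hn => (hN n hn).1
  have hpairs : ∀ j : ℕ,
      (pairPoint ρ N (2 * j) : ℂ) = ((1 - 1 / (2 : ℝ) ^ (N + j) : ℝ) : ℂ) ∧
      (pairPoint ρ N (2 * j + 1) : ℂ) =
        ((1 - 1 / (2 : ℝ) ^ (N + j) + pairGap ρ (N + j) : ℝ) : ℂ) := fun j => by
    have h1 : (2 * j + 1) / 2 = j := by omega
    have h2 : (2 * j + 1) % 2 = 1 := by omega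
    constructor <;> simp [pairPoint, h1, h2]
  have hnorm : ∀ k, ‖(pairPoint ρ N k : ℂ)‖ = pairPoint ρ N k := fun k => by
    rw [Complex.norm_real, Real.norm_of_nonneg (pairPoint_bounds hgap k hN1).1.le]
  refine ⟨fun k => (pairPoint ρ N k : ℂ), fun k l hkl => ?_, fun k => ?_, ⟨N, hN1, hpairs⟩,
    ⟨6, by norm_num, fun k => ?_⟩, ?_⟩
  · by_contra hne
    have h := pairGap_le_dist hgap hne
    rw [Complex.ofReal_injective hkl, sub_self, abs_zero] at h
    exact (pairGap_pos ρ _).not_ge h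
  · rw [mem_ball_zero_iff, hnorm]
    exact (pairPoint_bounds hgap k hN1).2
  · simp only [hnorm]
    exact integratedCount_pairPoint_le hρ hN1 hgap k
  · rintro ε₀ hε₀ ⟨a, f, ha, haM, hf, hfz⟩
    exact not_exists_solution_of_pairs hρ hpairs hε₀ ha haM hf hfz
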